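/- Let $q$ be a prime power and $n\ge 2$. Let $V$ be a $2n$-dimensional vector space over $\mathrm{GF}(q^2)$ with a non-degenerate alternating form $B$, let $\varphi:\mathrm{GF}(q^2)\to\mathrm{GF}(q)$ be a nonzero $\mathrm{GF}(q)$-linear map, and regard $V$ as a $4n$-dimensional vector space over $\mathrm{GF}(q)$ with the form $f=\varphi\circ B$. Then $f$ is a non-degenerate alternating form; let $\mathcal W(4n-1,q)$ be the symplectic polar space of $\mathrm{PG}(4n-1,q)$ that it defines, and $\perp$ the associated polarity. Let $\mathcal F$ be Dye's spread, i.e. the set of the one-dimensional $\mathrm{GF}(q^2)$-subspaces of $V$, regarded as lines of $\mathrm{PG}(4n-1,q)$. Let $\mathcal O_1$ be the set of totally isotropic lines $\ell$ such that $\ell\not\subseteq s^\perp$ for every $s\in\mathcal F$ that meets $\ell$ non-trivially, and let $\mathcal O_2$ be the set of totally isotropic lines $\ell\notin\mathcal F$ such that $\ell\subseteq s^\perp$ for every $s\in\mathcal F$ that meets $\ell$ non-trivially. Put $\theta_{k,q}=q^k+\dots+q+1$. For $r$ odd, $r\ge 3$, a set $\mathcal L$ of totally isotropic lines of $\mathcal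 W(r,q)$ is an $m$-cover, where $0<m<\theta_{r-1,q}$, if every point of $\mathrm{PG}(r,q)$ lies on exactly $m$ lines of $\mathcal L$. It is $(r-2)$-dual of symplectic type if moreover, for every line $\ell$ of $\mathrm{PG}(r,q)$, $$|\{s\in\mathcal L: s\subseteq \ell^\perp\}|=\begin{cases}\dfrac{m\,\theta_{r-4,q}}{q+1}+q^{r-3}&\text{if }\ell\in\mathcal L,\\[2mm] \dfrac{m\,\theta_{r-4,q}}{q+1}&\text{if }\ell\notin\mathcal L,\end{cases}$$ with $\theta_{-1,q}=0$. Then $\mathcal F$ is a $1$-cover (a spread) of $\mathcal W(4n-1,q)$, each of $\mathcal O_1$, $\mathcal O_2$ is an $m$-cover of $\mathcal W(4n-1,q)$ for some $m$ (depending on the set), and all three covers are $(4n-3)$-dual of symplectic type. -/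

import Mathlib

open LinearMap (BilinForm)

/-- `qNumber q k = 1 + q + ⋯ + q ^ (k - 1)`, the number of points of `PG(k - 1, q)`; in the usual
notation this is `θ_{k-1,q}`, with `θ_{-1,q} = 0`. -/
def qNumber (q k : ℕ) : ℕ := ∑ i ∈ Finset.range k, q ^ i

section PolarSpace

variable {F V : Type*} [Field F] [AddCommGroup V] [Module F V]

/-- The form `f` on `V` defines a symplectic polar space `W(r, q)` of `PG(V) = PG(r, q)`, where
`q = |F|`. The associated polarity sends a subspace `U` to `f.orthogonal U`. -/
structure IsSymplecticPolarSpace (r : ℕ) (f : BilinForm F V) : Prop where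
  finrank_eq : Module.finrank F V = r + 1
  isAlt : f.IsAlt
  nondegenerate : f.Nondegenerate

/-- A subspace of `V` which is a line of the projective space `PG(V)`. -/
def IsProjLine (ℓ : Submodule F V) : Prop := Module.finrank F ℓ = 2

/-- The lines of the polar space of `f`: the totally isotropic lines of `PG(V)`. -/
def isotropicLines (f : BilinForm F V) : Set (Submodule F V) :=
  {ℓ | IsProjLine ℓ ∧ ℓ ≤ f.orthogonal ℓ}

/-- `L` is an `m`-cover of the symplectic polar space `W(r, q)` defined by `f`: a set of totally
isotropic lines such that every point lies on exactly `m` of them, where `0 < m < θ_{r-1,q}`. -/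
structure IsCover (r : ℕ) (f : BilinForm F V) (m : ℕ) (L : Set (Submodule F V)) : Prop where
  symplectic : IsSymplecticPolarSpace r f
  subset_lines : L ⊆ isotropicLines f
  pos : 0 < m
  lt : m < qNumber (Nat.card F) r
  card_through : ∀ P : Submodule F V, Module.finrank F P = 1 → {ℓ ∈ L | P ≤ ℓ}.ncard = m

/-- `L` is an `(r - 2)`-dual `m`-cover of symplectic type of `W(r, q)`: for every line `ℓ` of
`PG(r, q)`, the number of lines of `L` in the `(r - 2)`-space `ℓ^⊥` is
`m θ_{r-4,q} / (q + 1) + q ^ (r - 3)` if `ℓ ∈ L`, and `m θ_{r-4,q} / (q + 1)` if `ℓ ∉ L`. -/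
structure IsDualCoverOfSymplecticType (r : ℕ) (f : BilinForm F V) (m : ℕ)
    (L : Set (Submodule F V)) : Prop where
  cover : IsCover r f m L
  card_of_mem : ∀ ℓ : Submodule F V, IsProjLine ℓ → ℓ ∈ L →
    ({s ∈ L | s ≤ f.orthogonal ℓ}.ncard : ℚ) =
      (m : ℚ) * (qNumber (Nat.card F) (r - 3) : ℚ) / ((Nat.card F : ℚ) + 1)
        + (Nat.card F : ℚ) ^ (r - 3)
  card_of_not_mem : ∀ ℓ : Submodule F V, IsProjLine ℓ → ℓ ∉ L →
    ({s ∈ L | s ≤ f.orthogonal ℓ}.ncard : ℚ) =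
      (m : ℚ) * (qNumber (Nat.card F) (r - 3) : ℚ) / ((Nat.card F : ℚ) + 1)

/-- The totally isotropic lines that are conjugate to no member of the spread `S` which they meet
non-trivially. -/
def nonConjugateLines (f : BilinForm F V) (S : Set (Submodule F V)) : Set (Submodule F V) :=
  {ℓ ∈ isotropicLines f | ∀ s ∈ S, s ⊓ ℓ ≠ ⊥ → ¬ ℓ ≤ f.orthogonal s}

/-- The totally isotropic lines outside the spread `S` that are conjugate to every member of `S`
which they meet non-trivially. -/
def conjugateLines (f : BilinForm F V) (S : Set (Submodule F V)) : Set (Submodule F V) :=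
  {ℓ ∈ isotropicLines f | ℓ ∉ S ∧ ∀ s ∈ S, s ⊓ ℓ ≠ ⊥ → ℓ ≤ f.orthogonal s}

end PolarSpace

section Dye

variable {F K V : Type*} [Field F] [Field K] [Algebra F K] [AddCommGroup V]
  [Module K V] [Module F V] [IsScalarTower F K V]

/-- The `F`-bilinear form `(x, y) ↦ φ (B x y)` obtained from a `K`-bilinear form `B` and an
`F`-linear functional `φ` on `K`. For `K / F` quadratic and `φ` ranging over the nonzero
functionals, the forms `φ ∘ B` are those of the pencil of linear complexes fixed by `Sp(B)`. -/
def reducedForm (φ : K →ₗ[F] F) (B : BilinForm K V) : BilinForm F V :=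
  LinearMap.mk₂ F (fun x y => φ (B x y))
    (fun x x' y => by simp)
    (fun c x y => by
      rw [← algebraMap_smul K c x, map_smul, LinearMap.smul_apply, algebraMap_smul, map_smul])
    (fun x y y' => by simp)
    (fun c x y => by
      rw [← algebraMap_smul K c y, map_smul, algebraMap_smul, map_smul])

@[simp]
theorem reducedForm_apply (φ : K →ₗ[F] F) (B : BilinForm K V) (x y : V) :
    reducedForm φ B x y = φ (B x y) := rfl

/-- Dye's spread of `PG(V)`, `V` as a vector space over `F`: its members are the points of the
projective space of `V` over the quadratic extension `K`, regarded as lines over `F`. -/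
def dyeSpread (F K V : Type*) [Field F] [Field K] [Algebra F K] [AddCommGroup V]
    [Module K V] [Module F V] [IsScalarTower F K V] : Set (Submodule F V) :=
  {s | ∃ p : Submodule K V, Module.finrank K p = 1 ∧ s = p.restrictScalars F}

end Dye

/-!
The set `𝒪₁` consists of the totally isotropic lines of `f` on which `B` does not vanish, and `𝒪₂`
of the lines outside the spread on which `B` vanishes: a line `ℓ` is conjugate to the spread member
`K · P` through one of its points `P` if and only if `B` vanishes on `ℓ`, so the choice of `P` is
irrelevant. The difference of two nested dual covers is a dual cover. It remains to show that the
spread, the lines on which `B` vanishes, and all totally isotropic lines of `f` are dual covers.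

The last two are instances of one statement, for a form `B` over any extension `E` of `F`. The
lines through a point `P` of `ℓ^⊥` which lie in `ℓ^⊥` and on which `B` vanishes are the lines
through `P` in `ℓ^⊥ ∩ (E · P)^⊥`, a subspace whose dimension is determined by that of `ℓ ∩ E · P`.
Since `Q ≤ E · P` is a symmetric relation between points, counting the pairs of points `P` of `ℓ^⊥`
and `Q` of `ℓ` with `Q ≤ E · P` from the side of `Q` requires only the dimension of `ℓ^⊥ ∩ E · Q`,
which depends on whether `B` vanishes on `ℓ` but not on `Q`.

For the spread, `s ≤ ℓ^⊥` says that `s`, as a point over `K`, lies in the orthogonal complement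
of the `K`-span of `ℓ`, and this span has dimension `1` or `2` over `K` according as `ℓ` belongs to
the spread or not.
-/

open Submodule

section QNumber

theorem qNumber_two (q : ℕ) : qNumber q 2 = q + 1 := by
  simp [qNumber, Finset.sum_range_succ, add_comm]

theorem qNumber_add (q j k : ℕ) : qNumber q (j + k) = qNumber q j + q ^ j * qNumber q k := by
  simp only [qNumber, Finset.sum_range_add, Finset.mul_sum, pow_add]

theorem qNumber_succ (q k : ℕ) : qNumber q (k + 1) = qNumber q k + q ^ k :=
  Finset.sum_range_succ _ k

theorem qNumber_two_mul (q k : ℕ) : qNumber q (2 * k) = (q + 1) * qNumber (q ^ 2) k := by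
  induction k with
  | zero => rfl
  | succ k ih =>
    rw [Nat.mul_succ, qNumber_add, ih, qNumber_two, qNumber_succ, pow_mul]
    ring

theorem qNumber_strictMono {q : ℕ} (hq : 0 < q) : StrictMono (qNumber q) :=
  strictMono_nat_of_lt_succ fun k => by
    rw [qNumber_succ]
    exact Nat.lt_add_of_pos_right (pow_pos hq k)

theorem qNumber_mul_qNumber_add (q a c : ℕ) :
    qNumber q (a + c + 2) * qNumber q a + q ^ a * (qNumber q 2 * qNumber q c) =
      qNumber q (a + 2) * qNumber q (a + c) := by
  rw [qNumber_add q (a + c), qNumber_add q a 2, add_comm a c, qNumber_add q c a, pow_add]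
  ring

end QNumber

section DoubleCounting

variable {α β : Type*}

theorem finsum_mem_const_nat (s : Set α) (c : ℕ) : ∑ᶠ _ ∈ s, c = s.ncard * c := by
  rw [← finsum_one, finsum_mem_mul]
  simp only [one_mul]

open Classical in
theorem ncard_sep_eq_finsum_ite (s : Set α) (p : α → Prop) :
    {a ∈ s | p a}.ncard = ∑ᶠ a ∈ s, if p a then 1 else 0 := by
  rw [← finsum_one]
  refine finsum_congr fun a => ?_
  by_cases ha : a ∈ s <;> by_cases hp : p a <;> simp [ha, hp]

theorem finsum_mem_ncard_comm {s : Set α} {t : Set β} (hs : s.Finite) (ht : t.Finite)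
    (R : α → β → Prop) :
    ∑ᶠ a ∈ s, {b ∈ t | R a b}.ncard = ∑ᶠ b ∈ t, {a ∈ s | R a b}.ncard := by
  simp only [ncard_sep_eq_finsum_ite]
  exact finsum_mem_comm _ hs ht

end DoubleCounting

section ProjectiveGeometry

variable {F V : Type*} [Field F] [AddCommGroup V] [Module F V]

/-- The points of `PG(V)` which lie in the subspace `U`, as one-dimensional subspaces of `V`. -/
def projPoints (U : Submodule F V) : Set (Submodule F V) :=
  {P | Module.finrank F P = 1 ∧ P ≤ U}

theorem projPoints_nonempty {U : Submodule F V} (hU : U ≠ ⊥) : (projPoints U).Nonempty := by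
  obtain ⟨u, huU, hu⟩ := exists_mem_ne_zero_of_ne_bot hU
  exact ⟨span F {u}, finrank_span_singleton hu, by simpa using huU⟩

theorem ncard_projPoints [Finite F] (U : Submodule F V) :
    (projPoints U).ncard = qNumber (Nat.card F) (Module.finrank F U) := by
  have himage : projPoints U = map U.subtype '' {P | Module.finrank F P = 1} := by
    ext P
    constructor
    · rintro ⟨hP, hPU⟩
      exact ⟨P.submoduleOf U, ((submoduleOfEquivOfLe hPU).finrank_eq).trans hP,
        (map_comap_subtype U P).trans (inf_eq_right.2 hPU)⟩
    · rintro ⟨P, hP, rfl⟩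
      exact ⟨(finrank_map_subtype_eq U P).trans hP, map_subtype_le U P⟩
  rw [himage, Set.ncard_image_of_injective _ (map_injective_of_injective U.injective_subtype),
    qNumber, ← Projectivization.card_of_finrank F U rfl]
  exact Nat.card_congr (Projectivization.equivSubmodule F U).symm

theorem IsProjLine.ne_bot {ℓ : Submodule F V} (hℓ : IsProjLine ℓ) : ℓ ≠ ⊥ := by
  rintro rfl
  simp [IsProjLine] at hℓ

theorem IsProjLine.finiteDimensional {ℓ : Submodule F V} (hℓ : IsProjLine ℓ) :
    FiniteDimensional F ℓ :=
  Module.finite_of_finrank_pos (hℓ ▸ two_pos)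

theorem exists_eq_span_singleton {P : Submodule F V} (hP : Module.finrank F P = 1) :
    ∃ v ≠ 0, P = span F {v} :=
  (atom_iff_nonzero_span P).1 (isAtom_iff_finrank_eq_one.2 hP)

theorem IsProjLine.span_singleton_sup_eq {ℓ P : Submodule F V} (hℓ : IsProjLine ℓ)
    (hP : P ∈ projPoints ℓ) {u : V} (hu : u ∈ ℓ) (huP : u ∉ P) : span F {u} ⊔ P = ℓ := by
  have := hℓ.finiteDimensional
  have hle : span F {u} ⊔ P ≤ ℓ := sup_le (by simpa using hu) hP.2
  have := finiteDimensional_of_le hle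
  refine eq_of_le_of_finrank_le hle ?_
  rw [hℓ, Nat.succ_le_iff, ← hP.1]
  exact finrank_lt_finrank_of_lt (covBy_span_singleton_sup huP).lt

theorem finrank_map_mkQ_add_finrank [FiniteDimensional F V] {P U : Submodule F V} (hPU : P ≤ U) :
    Module.finrank F (U.map P.mkQ) + Module.finrank F P = Module.finrank F U := by
  rw [← LinearMap.finrank_range_add_finrank_ker (P.mkQ.domRestrict U),
    LinearMap.range_domRestrict, LinearMap.ker_domRestrict, ker_mkQ]
  exact congrArg _ (submoduleOfEquivOfLe hPU).finrank_eq.symm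

theorem ncard_between_finrank_add_one [Finite F] [FiniteDimensional F V] {P M : Submodule F V}
    (hPM : P ≤ M) {d : ℕ} (hM : Module.finrank F M = Module.finrank F P + d) :
    {U : Submodule F V | Module.finrank F U = Module.finrank F P + 1 ∧ P ≤ U ∧ U ≤ M}.ncard =
      qNumber (Nat.card F) d := by
  have hd : Module.finrank F (M.map P.mkQ) = d := by
    have := finrank_map_mkQ_add_finrank hPM
    omega
  have himage : projPoints (M.map P.mkQ) = map P.mkQ ''
      {U | Module.finrank F U = Module.finrank F P + 1 ∧ P ≤ U ∧ U ≤ M} := by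
    ext Q
    constructor
    · rintro ⟨hQ, hQM⟩
      have hPQ : P ≤ Q.comap P.mkQ := le_comap_mkQ P Q
      have hmap : (Q.comap P.mkQ).map P.mkQ = Q := map_comap_eq_self (by simp)
      refine ⟨Q.comap P.mkQ, ⟨?_, hPQ, ?_⟩, hmap⟩
      · rw [← finrank_map_mkQ_add_finrank hPQ, hmap, hQ, add_comm]
      · simpa [comap_map_mkQ, hPM] using comap_mono (f := P.mkQ) hQM
    · rintro ⟨U, ⟨hU, hPU, hUM⟩, rfl⟩
      have := finrank_map_mkQ_add_finrank hPU
      exact ⟨by omega, map_mono hUM⟩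
  rw [← hd, ← ncard_projPoints, himage, Set.InjOn.ncard_image]
  rintro U ⟨-, hPU, -⟩ U' ⟨-, hPU', -⟩ h
  simpa [comap_map_mkQ, hPU, hPU'] using congrArg (comap P.mkQ) h

theorem finsum_ncard_through_eq_ncard_mul [Finite F] [FiniteDimensional F V]
    {L : Set (Submodule F V)} (hL : ∀ ℓ ∈ L, IsProjLine ℓ) (W : Submodule F V) :
    ∑ᶠ P ∈ projPoints W, {ℓ ∈ L | P ≤ ℓ ∧ ℓ ≤ W}.ncard =
      {ℓ ∈ L | ℓ ≤ W}.ncard * qNumber (Nat.card F) 2 := by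
  have : Finite V := Module.finite_of_finite F
  calc ∑ᶠ P ∈ projPoints W, {ℓ ∈ L | P ≤ ℓ ∧ ℓ ≤ W}.ncard
      = ∑ᶠ P ∈ projPoints W, {ℓ ∈ {ℓ ∈ L | ℓ ≤ W} | P ≤ ℓ}.ncard := by
        simp only [Set.mem_ofPred_eq, and_assoc, and_comm]
    _ = ∑ᶠ ℓ ∈ {ℓ ∈ L | ℓ ≤ W}, {P ∈ projPoints W | P ≤ ℓ}.ncard :=
        finsum_mem_ncard_comm (Set.toFinite _) (Set.toFinite _) _
    _ = ∑ᶠ ℓ ∈ {ℓ ∈ L | ℓ ≤ W}, qNumber (Nat.card F) 2 := by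
        refine finsum_mem_congr rfl fun ℓ hℓ => ?_
        rw [← hL ℓ hℓ.1, ← ncard_projPoints]
        congr 1
        ext P
        exact ⟨fun hP => ⟨hP.1.1, hP.2⟩, fun hP => ⟨⟨hP.1, hP.2.trans hℓ.2⟩, hP.2⟩⟩
    _ = {ℓ ∈ L | ℓ ≤ W}.ncard * qNumber (Nat.card F) 2 := finsum_mem_const_nat _ _

end ProjectiveGeometry

section Orthogonal

variable {F V : Type*} [Field F] [AddCommGroup V] [Module F V] {f : BilinForm F V}

theorem mem_orthogonal_span_iff {s : Set V} {v : V} :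
    v ∈ f.orthogonal (span F s) ↔ ∀ u ∈ s, f u v = 0 :=
  span_le (p := LinearMap.ker (f.flip v))

theorem le_orthogonal_comm (hf : f.IsRefl) {U W : Submodule F V} :
    U ≤ f.orthogonal W ↔ W ≤ f.orthogonal U :=
  ⟨fun h _ hw _ hu => hf _ _ (h hu _ hw), fun h _ hu _ hw => hf _ _ (h hw _ hu)⟩

theorem orthogonal_sup (U W : Submodule F V) :
    f.orthogonal (U ⊔ W) = f.orthogonal U ⊓ f.orthogonal W :=
  ext fun v => sup_le_iff (c := LinearMap.ker (f.flip v))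

theorem finrank_orthogonal_inf_add_finrank [FiniteDimensional F V] (hf : f.Nondegenerate)
    (hf' : f.IsRefl) (U W : Submodule F V) :
    Module.finrank F (f.orthogonal U ⊓ W : Submodule F V) + Module.finrank F U =
      Module.finrank F (U ⊓ f.orthogonal W : Submodule F V) + Module.finrank F W := by
  have hinf : f.orthogonal U ⊓ W = f.orthogonal (U ⊔ f.orthogonal W) := by
    rw [orthogonal_sup, LinearMap.BilinForm.orthogonal_orthogonal hf hf']
  have hsup := finrank_sup_add_finrank_inf_eq U (f.orthogonal W)
  have hle := (U ⊔ f.orthogonal W).finrank_le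
  have hW := W.finrank_le
  rw [hinf, LinearMap.BilinForm.finrank_orthogonal hf]
  rw [LinearMap.BilinForm.finrank_orthogonal hf] at hsup
  omega

end Orthogonal

section ReducedForm

variable {F E V : Type*} [Field F] [Field E] [Algebra F E] [AddCommGroup V]
  [Module E V] [Module F V] [IsScalarTower F E V]

theorem reducedForm_id (f : BilinForm F V) : reducedForm LinearMap.id f = f := rfl

theorem eq_zero_of_forall_apply_mul_eq_zero {φ : E →ₗ[F] F} (hφ : φ ≠ 0) {b : E}
    (h : ∀ k, φ (k * b) = 0) : b = 0 := by
  by_contra hb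
  refine hφ (LinearMap.ext fun k => ?_)
  simpa [hb] using h (k * b⁻¹)

theorem isAlt_reducedForm (φ : E →ₗ[F] F) {B : BilinForm E V} (hB : B.IsAlt) :
    (reducedForm φ B).IsAlt := fun x => by simp [hB.self_eq_zero]

theorem nondegenerate_reducedForm {φ : E →ₗ[F] F} (hφ : φ ≠ 0) {B : BilinForm E V}
    (hB : B.Nondegenerate) : (reducedForm φ B).Nondegenerate := by
  refine ⟨fun x hx => hB.1 x fun y => ?_, fun y hy => hB.2 y fun x => ?_⟩
  · exact eq_zero_of_forall_apply_mul_eq_zero hφ fun k => by simpa using hx (k • y)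
  · exact eq_zero_of_forall_apply_mul_eq_zero hφ fun k => by simpa using hy (k • x)

theorem isSymplecticPolarSpace_reducedForm {r : ℕ} (hr : Module.finrank F V = r + 1)
    {φ : E →ₗ[F] F} (hφ : φ ≠ 0) {B : BilinForm E V} (hB : B.IsAlt) (hB' : B.Nondegenerate) :
    IsSymplecticPolarSpace r (reducedForm φ B) :=
  ⟨hr, isAlt_reducedForm φ hB, nondegenerate_reducedForm hφ hB'⟩

theorem orthogonal_reducedForm_restrictScalars {φ : E →ₗ[F] F} (hφ : φ ≠ 0) (B : BilinForm E V)
    (p : Submodule E V) :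
    (reducedForm φ B).orthogonal (p.restrictScalars F) = (B.orthogonal p).restrictScalars F := by
  ext v
  refine ⟨fun h u hu => eq_zero_of_forall_apply_mul_eq_zero hφ fun k => ?_, fun h u hu => ?_⟩
  · simpa using h (k • u) (p.smul_mem k hu)
  · simpa using congrArg φ (h u hu)

end ReducedForm

section ExtSpan

variable {F E V : Type*} [Field F] [Field E] [Algebra F E] [AddCommGroup V]
  [Module E V] [Module F V] [IsScalarTower F E V]

variable (E) in
/-- The `E`-span `E · U` of an `F`-subspace `U` of an `E`-vector space, regarded as an
`F`-subspace. If `U` is a point of `PG(V)` over `F`, this is the point over `E` containing it. -/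
def extSpan (U : Submodule F V) : Submodule F V :=
  (span E (U : Set V)).restrictScalars F

theorem le_extSpan (U : Submodule F V) : U ≤ extSpan E U := subset_span

theorem mem_orthogonal_extSpan_iff {φ : E →ₗ[F] F} (hφ : φ ≠ 0) {B : BilinForm E V}
    {U : Submodule F V} {v : V} :
    v ∈ (reducedForm φ B).orthogonal (extSpan E U) ↔ ∀ u ∈ U, B u v = 0 := by
  rw [extSpan, orthogonal_reducedForm_restrictScalars hφ, restrictScalars_mem,
    mem_orthogonal_span_iff]
  rfl

theorem finrank_span_le_finrank (U : Submodule F V) [FiniteDimensional F U] :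
    Module.finrank E (span E (U : Set V)) ≤ Module.finrank F U := by
  let b := Module.finBasis F U
  have hspan : span F (Set.range (U.subtype ∘ b)) = U := by
    rw [Set.range_comp, span_image, b.span_eq, map_subtype_top]
  have hspanE : span E (Set.range (U.subtype ∘ b)) = span E (U : Set V) := by
    rw [← span_span_of_tower F E, hspan]
  rw [← hspanE]
  exact (finrank_range_le_card (R := E) _).trans_eq (Fintype.card_fin _)

theorem finrank_span_of_finrank_eq_one {P : Submodule F V} (hP : Module.finrank F P = 1) :
    Module.finrank E (span E (P : Set V)) = 1 := by
  obtain ⟨v, hv, rfl⟩ := exists_eq_span_singleton hP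
  rw [span_span_of_tower, finrank_span_singleton hv]

theorem finrank_extSpan (U : Submodule F V) :
    Module.finrank F (extSpan E U) = Module.finrank F E * Module.finrank E (span E (U : Set V)) :=
  (Module.finrank_mul_finrank F E (span E (U : Set V))).symm

theorem finrank_extSpan_of_finrank_eq_one {P : Submodule F V} (hP : Module.finrank F P = 1) :
    Module.finrank F (extSpan E P) = Module.finrank F E := by
  rw [finrank_extSpan, finrank_span_of_finrank_eq_one hP, mul_one]

theorem restrictScalars_eq_extSpan {p : Submodule E V} (hp : Module.finrank E p = 1)
    {P : Submodule F V} (hP : Module.finrank F P = 1) (hPp : P ≤ p.restrictScalars F) :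
    p.restrictScalars F = extSpan E P := by
  have : FiniteDimensional E p := Module.finite_of_finrank_pos (by omega)
  have hspan : span E (P : Set V) = p :=
    eq_of_le_of_finrank_eq (span_le.2 hPp) ((finrank_span_of_finrank_eq_one hP).trans hp.symm)
  rw [extSpan, hspan]

theorem extSpan_eq_of_le {P Q : Submodule F V} (hP : Module.finrank F P = 1)
    (hQ : Module.finrank F Q = 1) (hPQ : P ≤ extSpan E Q) : extSpan E Q = extSpan E P :=
  restrictScalars_eq_extSpan (finrank_span_of_finrank_eq_one hQ) hP hPQ

theorem le_extSpan_comm {P Q : Submodule F V} (hP : Module.finrank F P = 1)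
    (hQ : Module.finrank F Q = 1) : P ≤ extSpan E Q ↔ Q ≤ extSpan E P :=
  ⟨fun h => (le_extSpan Q).trans_eq (extSpan_eq_of_le hP hQ h),
    fun h => (le_extSpan P).trans_eq (extSpan_eq_of_le hQ hP h)⟩

theorem finsum_ncard_projPoints_inf_extSpan_comm [Finite F] [FiniteDimensional F V]
    (U W : Submodule F V) :
    ∑ᶠ P ∈ projPoints W, (projPoints (U ⊓ extSpan E P)).ncard =
      ∑ᶠ Q ∈ projPoints U, (projPoints (W ⊓ extSpan E Q)).ncard := by
  have : Finite V := Module.finite_of_finite F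
  have projPoints_inf (A C : Submodule F V) :
      projPoints (A ⊓ C) = {P ∈ projPoints A | P ≤ C} := by
    ext P
    simp only [projPoints, le_inf_iff, Set.mem_ofPred_eq, and_assoc]
  simp only [projPoints_inf]
  rw [finsum_mem_ncard_comm (Set.toFinite _) (Set.toFinite _)]
  refine finsum_mem_congr rfl fun Q hQ => congrArg Set.ncard (Set.ext fun P => ?_)
  exact and_congr_right fun hP => le_extSpan_comm hQ.1 hP.1

end ExtSpan

section DualCover

variable {F V : Type*} [Field F] [AddCommGroup V] [Module F V] {r : ℕ} {f : BilinForm F V}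

theorem IsCover.isDualCoverOfSymplecticType {m : ℕ} {L : Set (Submodule F V)}
    (hL : IsCover r f m L)
    (h_mem : ∀ ℓ ∈ L, {s ∈ L | s ≤ f.orthogonal ℓ}.ncard * (Nat.card F + 1) =
      m * qNumber (Nat.card F) (r - 3) + (Nat.card F + 1) * Nat.card F ^ (r - 3))
    (h_notMem : ∀ ℓ, IsProjLine ℓ → ℓ ∉ L → {s ∈ L | s ≤ f.orthogonal ℓ}.ncard *
      (Nat.card F + 1) = m * qNumber (Nat.card F) (r - 3)) :
    IsDualCoverOfSymplecticType r f m L where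
  cover := hL
  card_of_mem ℓ _ hℓL := by
    field_simp
    exact_mod_cast h_mem ℓ hℓL
  card_of_not_mem ℓ hℓ hℓL := by
    rw [eq_div_iff (by positivity)]
    exact_mod_cast h_notMem ℓ hℓ hℓL

theorem ncard_sep_sdiff {α : Type*} {S T : Set α} (hT : T.Finite) (hST : S ⊆ T) (p : α → Prop) :
    {x ∈ T \ S | p x}.ncard + {x ∈ S | p x}.ncard = {x ∈ T | p x}.ncard := by
  have hsub : {x ∈ S | p x} ⊆ {x ∈ T | p x} := fun x hx => ⟨hST hx.1, hx.2⟩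
  rw [← Set.ncard_sdiff_add_ncard_of_subset hsub (hT.subset (Set.sep_subset _ _))]
  congr 2
  ext x
  simp only [Set.mem_ofPred_eq, Set.mem_sdiff]
  tauto

theorem IsDualCoverOfSymplecticType.sdiff [Finite V] {a b : ℕ} {S T : Set (Submodule F V)}
    (hS : IsDualCoverOfSymplecticType r f a S) (hT : IsDualCoverOfSymplecticType r f b T)
    (hST : S ⊆ T) (hab : a < b) : IsDualCoverOfSymplecticType r f (b - a) (T \ S) := by
  have ncard_sdiff (ℓ : Submodule F V) : ({s ∈ T \ S | s ≤ f.orthogonal ℓ}.ncard : ℚ) =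
      {s ∈ T | s ≤ f.orthogonal ℓ}.ncard - {s ∈ S | s ≤ f.orthogonal ℓ}.ncard :=
    eq_sub_of_add_eq (mod_cast ncard_sep_sdiff T.toFinite hST _)
  constructor
  case cover =>
    refine ⟨hT.cover.symplectic, fun ℓ hℓ => hT.cover.subset_lines hℓ.1, Nat.sub_pos_of_lt hab,
      (Nat.sub_le b a).trans_lt hT.cover.lt, fun P hP => ?_⟩
    rw [← hT.cover.card_through P hP, ← hS.cover.card_through P hP]
    exact Nat.eq_sub_of_add_eq (ncard_sep_sdiff T.toFinite hST _)
  case card_of_mem =>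
    intro ℓ hℓ hmem
    rw [ncard_sdiff, hT.card_of_mem ℓ hℓ hmem.1, hS.card_of_not_mem ℓ hℓ hmem.2,
      Nat.cast_sub hab.le]
    ring
  case card_of_not_mem =>
    intro ℓ hℓ hmem
    rw [ncard_sdiff, Nat.cast_sub hab.le]
    by_cases hℓS : ℓ ∈ S
    · rw [hT.card_of_mem ℓ hℓ (hST hℓS), hS.card_of_mem ℓ hℓ hℓS]
      ring
    · rw [hT.card_of_not_mem ℓ hℓ fun hℓT => hmem ⟨hℓT, hℓS⟩, hS.card_of_not_mem ℓ hℓ hℓS]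
      ring

end DualCover

section ExtIsotropicLines

variable {F E V : Type*} [Field F] [Field E] [Algebra F E] [AddCommGroup V]
  [Module E V] [Module F V] [IsScalarTower F E V]

variable (F) in
/-- The lines of `PG(V)` over `F` on which the `E`-bilinear form `B` vanishes identically. They are
totally isotropic for every form `φ ∘ B`, and for `E = F` they are all the totally isotropic lines
of `B`. -/
def extIsotropicLines (B : BilinForm E V) : Set (Submodule F V) :=
  {ℓ | IsProjLine ℓ ∧ ∀ u ∈ ℓ, ∀ v ∈ ℓ, B u v = 0}

theorem extIsotropicLines_subset_isotropicLines (φ : E →ₗ[F] F) (B : BilinForm E V) :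
    extIsotropicLines F B ⊆ isotropicLines (reducedForm φ B) := by
  rintro ℓ ⟨hℓ, h⟩
  exact ⟨hℓ, fun v hv u hu => by simp [h u hu v hv]⟩

theorem isotropicLines_eq_extIsotropicLines (f : BilinForm F V) :
    isotropicLines f = extIsotropicLines F f :=
  Set.ext fun _ => and_congr_right fun _ =>
    ⟨fun h u hu _ hv => h hv u hu, fun h v hv u hu => h u hu v hv⟩

variable {φ : E →ₗ[F] F} {B : BilinForm E V}

theorem le_orthogonal_extSpan_self (hφ : φ ≠ 0) (hB : B.IsAlt) {P : Submodule F V}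
    (hP : Module.finrank F P = 1) : P ≤ (reducedForm φ B).orthogonal (extSpan E P) := by
  obtain ⟨v, -, rfl⟩ := exists_eq_span_singleton hP
  rw [span_singleton_le_iff_mem, mem_orthogonal_extSpan_iff hφ]
  intro u hu
  obtain ⟨c, rfl⟩ := mem_span_singleton.1 hu
  rw [← algebraMap_smul E c v, map_smul, LinearMap.smul_apply, hB.self_eq_zero, smul_zero]

theorem mem_extIsotropicLines_iff_le_orthogonal (hφ : φ ≠ 0) (hB : B.IsAlt) {ℓ P : Submodule F V}
    (hℓ : IsProjLine ℓ) (hP : P ∈ projPoints ℓ) :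
    ℓ ∈ extIsotropicLines F B ↔ ℓ ≤ (reducedForm φ B).orthogonal (extSpan E P) := by
  refine ⟨fun h v hv => (mem_orthogonal_extSpan_iff hφ).2 fun u hu => h.2 u (hP.2 hu) v hv,
    fun h => ⟨hℓ, fun u hu v hv => ?_⟩⟩
  have apply_eq_zero {p w : V} (hp : p ∈ P) (hw : w ∈ ℓ) : B p w = 0 :=
    (mem_orthogonal_extSpan_iff hφ).1 (h hw) p hp
  by_cases huP : u ∈ P
  · exact apply_eq_zero huP hv
  · rw [← hℓ.span_singleton_sup_eq hP hu huP, mem_sup] at hv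
    obtain ⟨_, hc, p, hp, rfl⟩ := hv
    obtain ⟨c, rfl⟩ := mem_span_singleton.1 hc
    rw [map_add, hB.isRefl _ _ (apply_eq_zero hp hu), ← algebraMap_smul E c u, map_smul,
      hB.self_eq_zero, smul_zero, add_zero]

theorem ncard_extIsotropicLines_through [Finite F] [FiniteDimensional F V] (hφ : φ ≠ 0)
    (hB : B.IsAlt) {P W : Submodule F V} (hP : P ∈ projPoints W) {d : ℕ}
    (hd : Module.finrank F (W ⊓ (reducedForm φ B).orthogonal (extSpan E P) : Submodule F V) =
      1 + d) :
    {ℓ ∈ extIsotropicLines F B | P ≤ ℓ ∧ ℓ ≤ W}.ncard = qNumber (Nat.card F) d := by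
  have hle := le_inf hP.2 (le_orthogonal_extSpan_self hφ hB hP.1)
  rw [← ncard_between_finrank_add_one hle (by rw [hd, hP.1]), hP.1]
  congr 1
  ext ℓ
  constructor
  · rintro ⟨h, hPℓ, hℓW⟩
    have hℓP := (mem_extIsotropicLines_iff_le_orthogonal hφ hB h.1 ⟨hP.1, hPℓ⟩).1 h
    exact ⟨h.1, hPℓ, le_inf hℓW hℓP⟩
  · rintro ⟨hℓ, hPℓ, hℓM⟩
    have hℓP := hℓM.trans inf_le_right
    exact ⟨(mem_extIsotropicLines_iff_le_orthogonal hφ hB hℓ ⟨hP.1, hPℓ⟩).2 hℓP, hPℓ,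
      hℓM.trans inf_le_left⟩

theorem finrank_orthogonal_inf_orthogonal_extSpan [FiniteDimensional F V] (hφ : φ ≠ 0)
    (hB : B.IsAlt) (hB' : B.Nondegenerate) {P ℓ : Submodule F V} (hP : Module.finrank F P = 1)
    (hℓ : IsProjLine ℓ) :
    Module.finrank F ((reducedForm φ B).orthogonal ℓ ⊓
        (reducedForm φ B).orthogonal (extSpan E P) : Submodule F V) + Module.finrank F E + 2 =
      Module.finrank F (ℓ ⊓ extSpan E P : Submodule F V) + Module.finrank F V := by
  have hf := nondegenerate_reducedForm hφ hB'
  have hf' := (isAlt_reducedForm φ hB).isRefl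
  have h := finrank_orthogonal_inf_add_finrank hf hf' ℓ
    ((reducedForm φ B).orthogonal (extSpan E P))
  have hE := finrank_extSpan_of_finrank_eq_one (E := E) hP
  have hle := (extSpan E P).finrank_le
  rw [LinearMap.BilinForm.orthogonal_orthogonal hf hf', LinearMap.BilinForm.finrank_orthogonal hf,
    hE, hℓ] at h
  omega

theorem finrank_orthogonal_inf_extSpan [FiniteDimensional F V] (hφ : φ ≠ 0)
    (hB : B.IsAlt) (hB' : B.Nondegenerate) {ℓ Q : Submodule F V} (hℓ : IsProjLine ℓ)
    (hQ : Q ∈ projPoints ℓ) :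
    Module.finrank F ((reducedForm φ B).orthogonal ℓ ⊓ extSpan E Q : Submodule F V) + 2 =
      Module.finrank F (ℓ ⊓ (reducedForm φ B).orthogonal (extSpan E Q) : Submodule F V) +
        Module.finrank F E := by
  have h := finrank_orthogonal_inf_add_finrank (nondegenerate_reducedForm hφ hB')
    (isAlt_reducedForm φ hB).isRefl ℓ (extSpan E Q)
  rwa [finrank_extSpan_of_finrank_eq_one hQ.1, hℓ] at h

theorem finrank_inf_orthogonal_extSpan_of_mem (hφ : φ ≠ 0) (hB : B.IsAlt) {ℓ Q : Submodule F V}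
    (hℓ : ℓ ∈ extIsotropicLines F B) (hQ : Q ∈ projPoints ℓ) :
    Module.finrank F (ℓ ⊓ (reducedForm φ B).orthogonal (extSpan E Q) : Submodule F V) = 2 := by
  rw [inf_eq_left.2 ((mem_extIsotropicLines_iff_le_orthogonal hφ hB hℓ.1 hQ).1 hℓ)]
  exact hℓ.1

theorem finrank_inf_orthogonal_extSpan_of_notMem (hφ : φ ≠ 0) (hB : B.IsAlt)
    {ℓ Q : Submodule F V} (hℓ : IsProjLine ℓ) (hℓB : ℓ ∉ extIsotropicLines F B)
    (hQ : Q ∈ projPoints ℓ) :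
    Module.finrank F (ℓ ⊓ (reducedForm φ B).orthogonal (extSpan E Q) : Submodule F V) = 1 := by
  have := hℓ.finiteDimensional
  have hlt : ℓ ⊓ (reducedForm φ B).orthogonal (extSpan E Q) < ℓ :=
    inf_lt_left.2 fun h => hℓB ((mem_extIsotropicLines_iff_le_orthogonal hφ hB hℓ hQ).2 h)
  have hgt := finrank_mono (le_inf hQ.2 (le_orthogonal_extSpan_self hφ hB hQ.1))
  have hlt' := finrank_lt_finrank_of_lt hlt
  rw [hQ.1] at hgt
  rw [hℓ] at hlt'
  omega

section Counting

variable [Finite F] [FiniteDimensional F V] (hφ : φ ≠ 0) (hB : B.IsAlt) (hB' : B.Nondegenerate)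
  {a c : ℕ} (hE : Module.finrank F E = c + 1) (hV : Module.finrank F V = a + c + 4)
include hφ hB hB' hE hV

theorem ncard_extIsotropicLines_le_orthogonal_mul {ℓ : Submodule F V} (hℓ : IsProjLine ℓ) {d : ℕ}
    (hd : ∀ Q ∈ projPoints ℓ, Module.finrank F
      ((reducedForm φ B).orthogonal ℓ ⊓ extSpan E Q : Submodule F V) = d) :
    {s ∈ extIsotropicLines F B | s ≤ (reducedForm φ B).orthogonal ℓ}.ncard *
        qNumber (Nat.card F) 2 =
      qNumber (Nat.card F) (a + c + 2) * qNumber (Nat.card F) a +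
        Nat.card F ^ a * (qNumber (Nat.card F) 2 * qNumber (Nat.card F) d) := by
  have : Finite V := Module.finite_of_finite F
  set q := Nat.card F
  set W := (reducedForm φ B).orthogonal ℓ with hW_def
  have hW : Module.finrank F W = a + c + 2 := by
    rw [LinearMap.BilinForm.finrank_orthogonal (nondegenerate_reducedForm hφ hB'), hV, hℓ]
    omega
  have hthrough : ∀ P ∈ projPoints W, {s ∈ extIsotropicLines F B | P ≤ s ∧ s ≤ W}.ncard =
      qNumber q a + q ^ a * (projPoints (ℓ ⊓ extSpan E P)).ncard := by
    intro P hP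
    rw [ncard_projPoints, ← qNumber_add]
    refine ncard_extIsotropicLines_through hφ hB hP ?_
    have := finrank_orthogonal_inf_orthogonal_extSpan hφ hB hB' hP.1 hℓ
    rw [← hW_def] at this
    omega
  calc {s ∈ extIsotropicLines F B | s ≤ W}.ncard * qNumber q 2
      = ∑ᶠ P ∈ projPoints W, {s ∈ extIsotropicLines F B | P ≤ s ∧ s ≤ W}.ncard :=
        (finsum_ncard_through_eq_ncard_mul (fun s hs => hs.1) W).symm
    _ = ∑ᶠ P ∈ projPoints W, (qNumber q a + q ^ a * (projPoints (ℓ ⊓ extSpan E P)).ncard) :=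
        finsum_mem_congr rfl hthrough
    _ = (projPoints W).ncard * qNumber q a +
          q ^ a * ∑ᶠ P ∈ projPoints W, (projPoints (ℓ ⊓ extSpan E P)).ncard := by
        rw [finsum_mem_add_distrib (Set.toFinite _), finsum_mem_const_nat, mul_finsum_mem]
    _ = (projPoints W).ncard * qNumber q a +
          q ^ a * ∑ᶠ Q ∈ projPoints ℓ, (projPoints (W ⊓ extSpan E Q)).ncard := by
        rw [finsum_ncard_projPoints_inf_extSpan_comm]
    _ = (projPoints W).ncard * qNumber q a + q ^ a * ∑ᶠ _ ∈ projPoints ℓ, qNumber q d := by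
        congr 2
        exact finsum_mem_congr rfl fun Q hQ => by rw [ncard_projPoints, hd Q hQ]
    _ = qNumber q (a + c + 2) * qNumber q a +
          q ^ a * (qNumber q 2 * qNumber q d) := by
        rw [finsum_mem_const_nat, ncard_projPoints, ncard_projPoints, hW, hℓ]

theorem ncard_extIsotropicLines_le_orthogonal_mul_of_mem {ℓ : Submodule F V}
    (hℓB : ℓ ∈ extIsotropicLines F B) :
    {s ∈ extIsotropicLines F B | s ≤ (reducedForm φ B).orthogonal ℓ}.ncard * (Nat.card F + 1) =
      qNumber (Nat.card F) (a + 2) * qNumber (Nat.card F) (a + c) +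
        (Nat.card F + 1) * Nat.card F ^ (a + c) := by
  have hd : ∀ Q ∈ projPoints ℓ, Module.finrank F
      ((reducedForm φ B).orthogonal ℓ ⊓ extSpan E Q : Submodule F V) = c + 1 := fun Q hQ => by
    have h := finrank_orthogonal_inf_extSpan hφ hB hB' hℓB.1 hQ
    rw [finrank_inf_orthogonal_extSpan_of_mem hφ hB hℓB hQ] at h
    omega
  rw [← qNumber_two, ncard_extIsotropicLines_le_orthogonal_mul hφ hB hB' hE hV hℓB.1 hd,
    ← qNumber_mul_qNumber_add, qNumber_succ _ c]
  ring

theorem ncard_extIsotropicLines_le_orthogonal_mul_of_notMem {ℓ : Submodule F V} (hℓ : IsProjLine ℓ)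
    (hℓB : ℓ ∉ extIsotropicLines F B) :
    {s ∈ extIsotropicLines F B | s ≤ (reducedForm φ B).orthogonal ℓ}.ncard * (Nat.card F + 1) =
      qNumber (Nat.card F) (a + 2) * qNumber (Nat.card F) (a + c) := by
  have hd : ∀ Q ∈ projPoints ℓ, Module.finrank F
      ((reducedForm φ B).orthogonal ℓ ⊓ extSpan E Q : Submodule F V) = c := fun Q hQ => by
    have h := finrank_orthogonal_inf_extSpan hφ hB hB' hℓ hQ
    rw [finrank_inf_orthogonal_extSpan_of_notMem hφ hB hℓ hℓB hQ] at h
    omega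
  rw [← qNumber_two, ncard_extIsotropicLines_le_orthogonal_mul hφ hB hB' hE hV hℓ hd,
    qNumber_mul_qNumber_add]

theorem isCover_extIsotropicLines :
    IsCover (a + c + 3) (reducedForm φ B) (qNumber (Nat.card F) (a + 2))
      (extIsotropicLines F B) where
  symplectic := isSymplecticPolarSpace_reducedForm hV hφ hB hB'
  subset_lines := extIsotropicLines_subset_isotropicLines φ B
  pos := (Nat.zero_le _).trans_lt (qNumber_strictMono Nat.card_pos (Nat.succ_pos _))
  lt := qNumber_strictMono Nat.card_pos (by omega)
  card_through P hP := by
    rw [← ncard_extIsotropicLines_through hφ hB (P := P) (W := ⊤) ⟨hP, le_top⟩]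
    · simp only [le_top, and_true]
    · rw [top_inf_eq, LinearMap.BilinForm.finrank_orthogonal (nondegenerate_reducedForm hφ hB'),
        finrank_extSpan_of_finrank_eq_one hP]
      omega

end Counting

theorem isDualCover_extIsotropicLines [Finite F] (hφ : φ ≠ 0) (hB : B.IsAlt)
    (hB' : B.Nondegenerate) {r : ℕ} (hr : Module.finrank F V = r + 1)
    (hEr : Module.finrank F E + 2 ≤ r) :
    IsDualCoverOfSymplecticType r (reducedForm φ B)
      (qNumber (Nat.card F) (r - Module.finrank F E)) (extIsotropicLines F B) := by
  have : FiniteDimensional F V := Module.finite_of_finrank_pos (by omega)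
  have : Nontrivial V := Module.nontrivial_of_finrank_pos (R := F) (by omega)
  have : FiniteDimensional F E := FiniteDimensional.left F E V
  obtain ⟨c, hc⟩ := Nat.exists_eq_add_one.2 (Module.finrank_pos (R := F) (M := E))
  obtain ⟨a, rfl⟩ : ∃ a, r = a + c + 3 := ⟨r - (c + 3), by omega⟩
  have ha : a + c + 3 - Module.finrank F E = a + 2 := by omega
  rw [ha]
  exact (isCover_extIsotropicLines hφ hB hB' hc hr).isDualCoverOfSymplecticType
    (fun _ h => ncard_extIsotropicLines_le_orthogonal_mul_of_mem hφ hB hB' hc hr h)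
    (fun _ hℓ h => ncard_extIsotropicLines_le_orthogonal_mul_of_notMem hφ hB hB' hc hr hℓ h)

theorem isDualCover_isotropicLines [Finite F] {r : ℕ} {f : BilinForm F V}
    (hf : IsSymplecticPolarSpace r f) (hr : 3 ≤ r) :
    IsDualCoverOfSymplecticType r f (qNumber (Nat.card F) (r - 1)) (isotropicLines f) := by
  have h := isDualCover_extIsotropicLines (φ := LinearMap.id)
    (fun h => one_ne_zero (LinearMap.congr_fun h (1 : F))) hf.isAlt hf.nondegenerate hf.finrank_eq
    (by rwa [Module.finrank_self, add_comm])
  rwa [reducedForm_id, ← isotropicLines_eq_extIsotropicLines, Module.finrank_self] at h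

end ExtIsotropicLines

section DyeSpread

variable {F K V : Type*} [Field F] [Field K] [Algebra F K] [AddCommGroup V]
  [Module K V] [Module F V] [IsScalarTower F K V]

theorem extSpan_mem_dyeSpread {P : Submodule F V} (hP : Module.finrank F P = 1) :
    extSpan K P ∈ dyeSpread F K V :=
  ⟨_, finrank_span_of_finrank_eq_one hP, rfl⟩

theorem eq_extSpan_of_mem_dyeSpread {s P : Submodule F V} (hs : s ∈ dyeSpread F K V)
    (hP : P ∈ projPoints s) : s = extSpan K P := by
  obtain ⟨p, hp, rfl⟩ := hs
  exact restrictScalars_eq_extSpan hp hP.1 hP.2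

theorem setOf_mem_dyeSpread_and_le {P : Submodule F V} (hP : Module.finrank F P = 1) :
    {s ∈ dyeSpread F K V | P ≤ s} = {extSpan K P} := by
  ext s
  refine ⟨fun hs => eq_extSpan_of_mem_dyeSpread hs.1 ⟨hP, hs.2⟩, ?_⟩
  rintro rfl
  exact ⟨extSpan_mem_dyeSpread hP, le_extSpan P⟩

theorem exists_mem_dyeSpread_inf_ne_bot {U : Submodule F V} (hU : U ≠ ⊥) :
    ∃ s ∈ dyeSpread F K V, s ⊓ U ≠ ⊥ := by
  obtain ⟨P, hP, hPU⟩ := projPoints_nonempty hU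
  refine ⟨extSpan K P, extSpan_mem_dyeSpread hP, fun h => ?_⟩
  rw [le_bot_iff.1 ((le_inf (le_extSpan P) hPU).trans_eq h), finrank_bot] at hP
  exact zero_ne_one hP

variable {φ : K →ₗ[F] F} {B : BilinForm K V}

theorem mem_extIsotropicLines_iff_le_orthogonal_of_mem_dyeSpread (hφ : φ ≠ 0) (hB : B.IsAlt)
    {ℓ s : Submodule F V} (hℓ : IsProjLine ℓ) (hs : s ∈ dyeSpread F K V) (hsℓ : s ⊓ ℓ ≠ ⊥) :
    ℓ ∈ extIsotropicLines F B ↔ ℓ ≤ (reducedForm φ B).orthogonal s := by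
  obtain ⟨P, hP, hPsℓ⟩ := projPoints_nonempty hsℓ
  rw [eq_extSpan_of_mem_dyeSpread hs ⟨hP, hPsℓ.trans inf_le_left⟩]
  exact mem_extIsotropicLines_iff_le_orthogonal hφ hB hℓ ⟨hP, hPsℓ.trans inf_le_right⟩

theorem nonConjugateLines_dyeSpread (hφ : φ ≠ 0) (hB : B.IsAlt) :
    nonConjugateLines (reducedForm φ B) (dyeSpread F K V) =
      isotropicLines (reducedForm φ B) \ extIsotropicLines F B := by
  refine Set.ext fun ℓ => and_congr_right fun hℓ => ⟨fun h hℓB => ?_, fun hℓB s hs hsℓ hle => ?_⟩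
  · obtain ⟨s, hs, hsℓ⟩ := exists_mem_dyeSpread_inf_ne_bot (K := K) hℓ.1.ne_bot
    exact h s hs hsℓ
      ((mem_extIsotropicLines_iff_le_orthogonal_of_mem_dyeSpread hφ hB hℓ.1 hs hsℓ).1 hℓB)
  · exact hℓB
      ((mem_extIsotropicLines_iff_le_orthogonal_of_mem_dyeSpread hφ hB hℓ.1 hs hsℓ).2 hle)

theorem conjugateLines_dyeSpread (hφ : φ ≠ 0) (hB : B.IsAlt) :
    conjugateLines (reducedForm φ B) (dyeSpread F K V) =
      extIsotropicLines F B \ dyeSpread F K V := by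
  ext ℓ
  constructor
  · rintro ⟨hℓ, hℓS, h⟩
    obtain ⟨s, hs, hsℓ⟩ := exists_mem_dyeSpread_inf_ne_bot (K := K) hℓ.1.ne_bot
    exact ⟨(mem_extIsotropicLines_iff_le_orthogonal_of_mem_dyeSpread hφ hB hℓ.1 hs hsℓ).2
      (h s hs hsℓ), hℓS⟩
  · rintro ⟨hℓB, hℓS⟩
    exact ⟨extIsotropicLines_subset_isotropicLines φ B hℓB, hℓS, fun s hs hsℓ =>
      (mem_extIsotropicLines_iff_le_orthogonal_of_mem_dyeSpread hφ hB hℓB.1 hs hsℓ).1 hℓB⟩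

theorem restrictScalars_le_orthogonal_iff (hφ : φ ≠ 0) (hB : B.IsAlt) {p : Submodule K V}
    {U : Submodule F V} :
    p.restrictScalars F ≤ (reducedForm φ B).orthogonal U ↔
      p ≤ B.orthogonal (span K (U : Set V)) := by
  rw [le_orthogonal_comm (isAlt_reducedForm φ hB).isRefl,
    orthogonal_reducedForm_restrictScalars hφ, le_orthogonal_comm hB.isRefl, span_le]
  rfl

theorem ncard_dyeSpread_le_orthogonal [Finite K] (hφ : φ ≠ 0) (hB : B.IsAlt)
    (U : Submodule F V) :
    {s ∈ dyeSpread F K V | s ≤ (reducedForm φ B).orthogonal U}.ncard =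
      qNumber (Nat.card K) (Module.finrank K (B.orthogonal (span K (U : Set V)))) := by
  have himage : {s ∈ dyeSpread F K V | s ≤ (reducedForm φ B).orthogonal U} =
      restrictScalars F '' projPoints (B.orthogonal (span K (U : Set V))) := by
    ext s
    constructor
    · rintro ⟨⟨p, hp, rfl⟩, hpU⟩
      exact ⟨p, ⟨hp, (restrictScalars_le_orthogonal_iff hφ hB).1 hpU⟩, rfl⟩
    · rintro ⟨p, ⟨hp, hpU⟩, rfl⟩
      exact ⟨⟨p, hp, rfl⟩, (restrictScalars_le_orthogonal_iff hφ hB).2 hpU⟩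
  rw [himage, Set.ncard_image_of_injective _ (restrictScalars_injective F K V), ncard_projPoints]

theorem finrank_span_of_mem_dyeSpread {s : Submodule F V} (hs : s ∈ dyeSpread F K V) :
    Module.finrank K (span K (s : Set V)) = 1 := by
  obtain ⟨p, hp, rfl⟩ := hs
  rwa [coe_restrictScalars, span_eq]

section Quadratic

variable (hK : Module.finrank F K = 2)
include hK

theorem isProjLine_of_mem_dyeSpread {s : Submodule F V} (hs : s ∈ dyeSpread F K V) :
    IsProjLine s := by
  obtain ⟨p, hp, rfl⟩ := hs
  have h := Module.finrank_mul_finrank F K p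
  rw [hp, hK] at h
  exact h.symm

theorem finrank_span_of_notMem_dyeSpread [FiniteDimensional F V] {ℓ : Submodule F V}
    (hℓ : IsProjLine ℓ) (hℓS : ℓ ∉ dyeSpread F K V) :
    Module.finrank K (span K (ℓ : Set V)) = 2 := by
  have hext := finrank_extSpan (E := K) ℓ
  have hle := finrank_span_le_finrank (E := K) ℓ
  have hge := finrank_mono (le_extSpan (E := K) ℓ)
  have hne_one : Module.finrank K (span K (ℓ : Set V)) ≠ 1 := by
    intro h
    have heq : ℓ = extSpan K ℓ := eq_of_le_of_finrank_eq (le_extSpan ℓ) (by rw [hext, h, hK, hℓ])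
    exact hℓS ⟨_, h, heq⟩
  rw [hℓ] at hle hge
  rw [hK] at hext
  omega

theorem dyeSpread_subset_extIsotropicLines (hB : B.IsAlt) :
    dyeSpread F K V ⊆ extIsotropicLines F B := by
  intro s hs
  refine ⟨isProjLine_of_mem_dyeSpread hK hs, ?_⟩
  obtain ⟨p, hp, rfl⟩ := hs
  obtain ⟨v, -, rfl⟩ := exists_eq_span_singleton hp
  intro x hx y hy
  obtain ⟨c, rfl⟩ := mem_span_singleton.1 hx
  obtain ⟨d, rfl⟩ := mem_span_singleton.1 hy
  simp [hB.self_eq_zero]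

variable [Finite F] (hφ : φ ≠ 0) (hB : B.IsAlt) (hB' : B.Nondegenerate)
include hφ hB hB'

theorem isCover_dyeSpread {r : ℕ} (hr : Module.finrank F V = r + 1) (hr' : 1 < r) :
    IsCover r (reducedForm φ B) 1 (dyeSpread F K V) where
  symplectic := isSymplecticPolarSpace_reducedForm hr hφ hB hB'
  subset_lines := (dyeSpread_subset_extIsotropicLines hK hB).trans
    (extIsotropicLines_subset_isotropicLines φ B)
  pos := one_pos
  lt := by simpa [qNumber] using qNumber_strictMono (Nat.card_pos (α := F)) hr'
  card_through P hP := by rw [setOf_mem_dyeSpread_and_le hP, Set.ncard_singleton]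

theorem isDualCover_dyeSpread {r : ℕ} (hr : Module.finrank F V = r + 1) (hr' : 3 ≤ r) :
    IsDualCoverOfSymplecticType r (reducedForm φ B) 1 (dyeSpread F K V) := by
  have : FiniteDimensional F K := Module.finite_of_finrank_pos (by omega)
  have : FiniteDimensional F V := Module.finite_of_finrank_pos (by omega)
  have : FiniteDimensional K V := Module.Finite.of_restrictScalars_finite F K V
  have : Finite K := Module.finite_of_finite F
  have hcard : Nat.card K = Nat.card F ^ 2 := by rw [Module.natCard_eq_pow_finrank (K := F), hK]
  have hmul := Module.finrank_mul_finrank F K V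
  rw [hK, hr] at hmul
  obtain ⟨k, hk⟩ : ∃ k, Module.finrank K V = k + 2 := ⟨Module.finrank K V - 2, by omega⟩
  obtain rfl : r = 2 * k + 3 := by omega
  refine (isCover_dyeSpread hK hφ hB hB' hr (by omega)).isDualCoverOfSymplecticType
    (fun ℓ hℓS => ?_) (fun ℓ hℓ hℓS => ?_)
  · rw [ncard_dyeSpread_le_orthogonal hφ hB, LinearMap.BilinForm.finrank_orthogonal hB', hk,
      finrank_span_of_mem_dyeSpread hℓS, hcard, Nat.add_sub_cancel, qNumber_two_mul,
      Nat.add_one_sub_one, qNumber_succ]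
    ring
  · rw [ncard_dyeSpread_le_orthogonal hφ hB, LinearMap.BilinForm.finrank_orthogonal hB', hk,
      finrank_span_of_notMem_dyeSpread hK hℓ hℓS, hcard, Nat.add_sub_cancel, Nat.add_sub_cancel,
      qNumber_two_mul]
    ring

end Quadratic

end DyeSpread

theorem mainTheorem7 {F K V : Type*} [Field F] [Finite F] [Field K] [Algebra F K]
    [AddCommGroup V] [Module K V] [Module F V] [IsScalarTower F K V]
    (hK : Module.finrank F K = 2)
    (n : ℕ) (hn : 2 ≤ n) (hV : Module.finrank K V = 2 * n)
    (B : LinearMap.BilinForm K V) (hB : B.IsAlt) (hB' : B.Nondegenerate)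
    (φ : K →ₗ[F] F) (hφ : φ ≠ 0) :
    IsDualCoverOfSymplecticType (4 * n - 1) (reducedForm φ B) 1 (dyeSpread F K V) ∧
    (∃ m : ℕ, IsDualCoverOfSymplecticType (4 * n - 1) (reducedForm φ B) m
      (nonConjugateLines (reducedForm φ B) (dyeSpread F K V))) ∧
    (∃ m : ℕ, IsDualCoverOfSymplecticType (4 * n - 1) (reducedForm φ B) m
      (conjugateLines (reducedForm φ B) (dyeSpread F K V))) := by
  have hr : Module.finrank F V = 4 * n - 1 + 1 := by
    rw [← Module.finrank_mul_finrank F K V, hK, hV]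
    omega
  have : FiniteDimensional F V := Module.finite_of_finrank_pos (by omega)
  have : Finite V := Module.finite_of_finite F
  have hmono := qNumber_strictMono (Nat.card_pos (α := F))
  have hS := isDualCover_dyeSpread hK hφ hB hB' hr (by omega)
  have hT := isDualCover_extIsotropicLines hφ hB hB' hr (by omega)
  have hI := isDualCover_isotropicLines hS.cover.symplectic (by omega)
  rw [hK] at hT
  refine ⟨hS, ?_, ?_⟩
  · rw [nonConjugateLines_dyeSpread hφ hB]
    exact ⟨_, hT.sdiff hI (extIsotropicLines_subset_isotropicLines φ B) (hmono (by omega))⟩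
  · rw [conjugateLines_dyeSpread hφ hB]
    refine ⟨_, hS.sdiff hT (dyeSpread_subset_extIsotropicLines hK hB) ?_⟩
    simpa [qNumber] using hmono (show 1 < 4 * n - 1 - 2 by omega)
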